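/- Let $G=GL(4,\mathbb R)$, $K=O(4)$, $A$ the group of positive diagonal matrices and $N$ the group of lower triangular unipotent matrices in $G$. Let $U(\mathfrak g)$ be the universal enveloping algebra of $\mathfrak{gl}(4,\mathbb C)$, acting on $C^\infty(G)$ by right differentiation, $R_Xf(g)=\frac{d}{dt}f(g\exp(tX))|_{t=0}$ for $X\in\mathfrak{gl}(4,\mathbb R)$. For $k\in\{1,2\}$ let $P_k\subset G$ be the lower block triangular parabolic subgroup with diagonal blocks $g_1\in GL(k,\mathbb R)$, $g_2\in GL(4-k,\mathbb R)$, and $\mathfrak p_k$ its Lie algebra. For $\lambda=(\lambda_1,\lambda_2)\in\mathbb C^2$ with $\lambda_1-\lambda_2\notin\mathbb Z$ let $d\lambda\colon\mathfrak p_k\to\mathbb C$ be the differential of the character $p\mapsto|\det g_1|^{\lambda_1}|\det g_2|^{\lambda_2}$ of $P_k$, and put $$J_k(\lambda)=\sum_{X\in\mathfrak p_k}U(\mathfrak g)\,(X-d\lambda(X)),\qquad I_k(\lambda)=\bigcap_{g\in G}\mathrm{Ad}(g)J_k(\lambda).$$ Let $\mathfrak s_{(\mathrm{II})}=\mathbb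 RE_{21}+\mathbb RE_{43}+\mathbb RE_{31}+\mathbb RE_{42}+\mathbb RE_{41}$, $S_{(\mathrm{II})}=\exp\mathfrak s_{(\mathrm{II})}\subset N$, and let $\chi$ be the unitary character of $S_{(\mathrm{II})}$ with $\chi(\exp X)=e^{2\pi\sqrt{-1}(X_{42}+X_{21})}$ for $X\in\mathfrak s_{(\mathrm{II})}$ (that is, $\chi=\chi_{l(0,0,1,1,0,0)}$). Let $$W_k=C^\infty_\chi(S_{(\mathrm{II})}\backslash G/K;I_k(\lambda))=\{f\in C^\infty(G)\mid f(sgk')=\chi(s)f(g)\ (s\in S_{(\mathrm{II})},\,g\in G,\,k'\in K),\ R_Df=0\ (D\in I_k(\lambda))\},$$ and let $\Xi$ send $f\in W_k$ to the function $\Xi(f)(u,a)=f(\exp(uE_{32})\,\mathrm{diag}(a_1,a_2,a_3,a_4))$ of $(u,a)\in\mathbb R\times(\mathbb R_{>0})^4\cong S_{(\mathrm{II})}\backslash N\times A$. Then, for both $k=1$ and $k=2$, $W_k=\{0\}$ and $\Xi(W_k)=\{0\}$. -/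

import Mathlib

open scoped Matrix ContDiff

noncomputable section

namespace GenWhittaker

attribute [local instance 100] LieRing.ofAssociativeRing

/-! ## Smooth functions on `GL(n, ℝ)` and right differentiation -/

section RightAction

variable {n : ℕ}

/-- Extension by zero of a function on `GL(n, ℝ)` to the space `ℝ^(n × n)` of all matrices. -/
def extendZero (f : GL (Fin n) ℝ → ℂ) (A : Fin n → Fin n → ℝ) : ℂ :=
  open Classical in if h : IsUnit (Matrix.of A) then f h.unit else 0

/-- The set of invertible matrices in `ℝ^(n × n)`. -/
def unitSet (n : ℕ) : Set (Fin n → Fin n → ℝ) := {A | IsUnit (Matrix.of A)}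

/-- `f : GL(n, ℝ) → ℂ` is of class `C^∞`, where `GL(n, ℝ)` is regarded as an open subset of
`ℝ^(n × n)`. -/
def IsSmooth (f : GL (Fin n) ℝ → ℂ) : Prop :=
  ContDiffOn ℝ ∞ (extendZero f) (unitSet n)

/-- The array of entries of an element of `GL(n, ℝ)`. -/
def entries (g : GL (Fin n) ℝ) : Fin n → Fin n → ℝ := Matrix.of.symm g.val

theorem entries_mem (g : GL (Fin n) ℝ) : entries g ∈ unitSet n := g.isUnit

theorem exists_entries {A : Fin n → Fin n → ℝ} (hA : A ∈ unitSet n) : ∃ g, entries g = A := by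
  obtain ⟨g, hg⟩ := hA
  exact ⟨g, congrArg Matrix.of.symm hg⟩

theorem extendZero_entries (f : GL (Fin n) ℝ → ℂ) (g : GL (Fin n) ℝ) :
    extendZero f (entries g) = f g := by
  have h : IsUnit (Matrix.of (entries g)) := g.isUnit
  unfold extendZero
  rw [dif_pos h]
  congr 1
  ext1
  rfl

theorem isOpen_unitSet : IsOpen (unitSet n) := by
  have h : unitSet n = (fun A : Fin n → Fin n → ℝ => (Matrix.of A).det) ⁻¹' {0}ᶜ := by
    ext A
    simp [unitSet, Matrix.isUnit_iff_isUnit_det, isUnit_iff_ne_zero]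
  rw [h]
  refine isOpen_compl_singleton.preimage ?_
  have : Continuous (fun A : Matrix (Fin n) (Fin n) ℝ => A.det) := continuous_id.matrix_det
  exact this

theorem unitSet_mem_nhds (g : GL (Fin n) ℝ) : unitSet n ∈ nhds (entries g) :=
  isOpen_unitSet.mem_nhds (entries_mem g)

/-- Right multiplication by a matrix, on arrays of entries. -/
def mulR (X : Matrix (Fin n) (Fin n) ℝ) :
    (Fin n → Fin n → ℝ) →L[ℝ] (Fin n → Fin n → ℝ) :=
  LinearMap.toContinuousLinearMap
    { toFun := fun A => Matrix.of.symm (Matrix.of A * X)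
      map_add' := fun A B => by
        change Matrix.of.symm ((Matrix.of A + Matrix.of B) * X) = _
        rw [add_mul]; rfl
      map_smul' := fun c A => by
        change Matrix.of.symm ((c • Matrix.of A) * X) = _
        rw [Matrix.smul_mul]; rfl }

theorem mulR_apply (X : Matrix (Fin n) (Fin n) ℝ) (A : Fin n → Fin n → ℝ) :
    mulR X A = Matrix.of.symm (Matrix.of A * X) := rfl

/-- `exp X` as an element of `GL(n, ℝ)`. -/
def expGL (X : Matrix (Fin n) (Fin n) ℝ) : GL (Fin n) ℝ :=
  (Matrix.isUnit_exp X).unit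

theorem coe_expGL (X : Matrix (Fin n) (Fin n) ℝ) :
    (expGL X).val = NormedSpace.exp X := rfl

section Norm

attribute [local instance] Matrix.linftyOpNormedRing Matrix.linftyOpNormedAlgebra

theorem hasDerivAt_exp_entry (X : Matrix (Fin n) (Fin n) ℝ) (i j : Fin n) :
    HasDerivAt (fun t : ℝ => (NormedSpace.exp (t • X) : Matrix (Fin n) (Fin n) ℝ) i j)
      (X i j) 0 := by
  have h1 := hasDerivAt_exp_smul_const (𝕂 := ℝ) X (0 : ℝ)
  rw [zero_smul, NormedSpace.exp_zero, one_mul] at h1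
  let e : Matrix (Fin n) (Fin n) ℝ →ₗ[ℝ] ℝ := Matrix.entryLinearMap ℝ ℝ i j
  have h2 := (LinearMap.toContinuousLinearMap e).hasFDerivAt.comp_hasDerivAt (0 : ℝ) h1
  exact h2

end Norm

/-- `(R_X f)(g) = d/dt f(g exp(tX)) |_{t = 0}`. -/
def rightDeriv (X : Matrix (Fin n) (Fin n) ℝ) (f : GL (Fin n) ℝ → ℂ) (g : GL (Fin n) ℝ) : ℂ :=
  deriv (fun t : ℝ => f (g * expGL (t • X))) 0

theorem differentiableAt_extendZero {f : GL (Fin n) ℝ → ℂ} (hf : IsSmooth f)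
    (g : GL (Fin n) ℝ) : DifferentiableAt ℝ (extendZero f) (entries g) :=
  (ContDiffOn.contDiffAt hf (unitSet_mem_nhds g)).differentiableAt (by simp)

theorem hasDerivAt_right {f : GL (Fin n) ℝ → ℂ} (hf : IsSmooth f)
    (X : Matrix (Fin n) (Fin n) ℝ) (g : GL (Fin n) ℝ) :
    HasDerivAt (fun t : ℝ => f (g * expGL (t • X)))
      (fderiv ℝ (extendZero f) (entries g) (mulR X (entries g))) 0 := by
  have h1 : HasDerivAt (fun t : ℝ => entries (g * expGL (t • X))) (mulR X (entries g)) 0 := by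
    rw [hasDerivAt_pi]
    intro i
    rw [hasDerivAt_pi]
    intro j
    have h := HasDerivAt.fun_sum (u := Finset.univ)
      (fun (m : Fin n) _ => (hasDerivAt_exp_entry X m j).const_mul (g.val i m))
    exact h
  have h0 : entries (g * expGL ((0 : ℝ) • X)) = entries g := by
    have : expGL ((0 : ℝ) • X) = 1 := by
      apply Units.ext
      rw [coe_expGL, zero_smul, NormedSpace.exp_zero]
      rfl
    rw [this, mul_one]
  have h2 : HasFDerivAt (extendZero f) (fderiv ℝ (extendZero f) (entries g))
      (entries (g * expGL ((0 : ℝ) • X))) := by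
    rw [h0]
    exact (differentiableAt_extendZero hf g).hasFDerivAt
  have h3 := h2.comp_hasDerivAt (0 : ℝ) h1
  refine h3.congr_of_eventuallyEq (Filter.Eventually.of_forall fun t => ?_)
  exact (extendZero_entries f _).symm

theorem rightDeriv_eq {f : GL (Fin n) ℝ → ℂ} (hf : IsSmooth f)
    (X : Matrix (Fin n) (Fin n) ℝ) (g : GL (Fin n) ℝ) :
    rightDeriv X f g = fderiv ℝ (extendZero f) (entries g) (mulR X (entries g)) :=
  (hasDerivAt_right hf X g).deriv

theorem extendZero_rightDeriv {f : GL (Fin n) ℝ → ℂ} (hf : IsSmooth f)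
    (X : Matrix (Fin n) (Fin n) ℝ) :
    Set.EqOn (extendZero (rightDeriv X f)) (fun A => fderiv ℝ (extendZero f) A (mulR X A))
      (unitSet n) := by
  intro A hA
  obtain ⟨g, rfl⟩ := exists_entries hA
  rw [extendZero_entries, rightDeriv_eq hf]

theorem IsSmooth.rightDeriv {f : GL (Fin n) ℝ → ℂ} (hf : IsSmooth f)
    (X : Matrix (Fin n) (Fin n) ℝ) : IsSmooth (rightDeriv X f) := by
  refine ContDiffOn.congr ?_ (extendZero_rightDeriv hf X)
  have h1 : ContDiffOn ℝ ∞ (fderiv ℝ (extendZero f)) (unitSet n) :=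
    ContDiffOn.fderiv_of_isOpen hf isOpen_unitSet (by simp)
  exact h1.clm_apply (mulR X).contDiff.contDiffOn

theorem rightDeriv_lie {f : GL (Fin n) ℝ → ℂ} (hf : IsSmooth f)
    (X Y : Matrix (Fin n) (Fin n) ℝ) (g : GL (Fin n) ℝ) :
    rightDeriv (X * Y - Y * X) f g
      = rightDeriv X (rightDeriv Y f) g - rightDeriv Y (rightDeriv X f) g := by
  have hc := ContDiffOn.contDiffAt hf (unitSet_mem_nhds g)
  have hd : DifferentiableAt ℝ (fderiv ℝ (extendZero f)) (entries g) :=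
    (hc.fderiv_right (m := 1) (by norm_cast)).differentiableAt (by simp)
  have key : ∀ V W : Matrix (Fin n) (Fin n) ℝ, rightDeriv V (rightDeriv W f) g
      = fderiv ℝ (fderiv ℝ (extendZero f)) (entries g) (mulR V (entries g)) (mulR W (entries g))
        + fderiv ℝ (extendZero f) (entries g) (mulR W (mulR V (entries g))) := by
    intro V W
    rw [rightDeriv_eq (hf.rightDeriv W)]
    have he : extendZero (rightDeriv W f) =ᶠ[nhds (entries g)]
        (fun A => fderiv ℝ (extendZero f) A (mulR W A)) :=
      (extendZero_rightDeriv hf W).eventuallyEq_of_mem (unitSet_mem_nhds g)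
    have hm := (hd.hasFDerivAt.clm_apply (mulR W).hasFDerivAt).fderiv
    rw [he.fderiv_eq, hm]
    simp [add_comm]
  have hsymm : IsSymmSndFDerivAt ℝ (extendZero f) (entries g) :=
    hc.isSymmSndFDerivAt (by simp [minSmoothness_of_isRCLikeNormedField]; norm_cast)
  have hXY : mulR (X * Y - Y * X) (entries g)
      = mulR Y (mulR X (entries g)) - mulR X (mulR Y (entries g)) := by
    change Matrix.of.symm (Matrix.of (entries g) * (X * Y - Y * X))
      = Matrix.of.symm (Matrix.of (entries g) * X * Y)
        - Matrix.of.symm (Matrix.of (entries g) * Y * X)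
    rw [mul_sub, ← mul_assoc, ← mul_assoc]
    rfl
  rw [key, key, rightDeriv_eq hf, hsymm.eq, hXY, map_sub]
  ring

variable (n) in
/-- The space `C^∞(G)` of complex valued smooth functions on `G = GL(n, ℝ)`. -/
def smoothFun : Submodule ℂ (GL (Fin n) ℝ → ℂ) where
  carrier := {f | IsSmooth f}
  add_mem' {f g} hf hg := by
    refine ContDiffOn.congr (ContDiffOn.add hf hg) fun A hA => ?_
    obtain ⟨x, rfl⟩ := exists_entries hA
    simp only [Pi.add_apply, extendZero_entries]
  zero_mem' := by
    refine ContDiffOn.congr (contDiffOn_const (c := (0 : ℂ))) fun A hA => ?_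
    obtain ⟨x, rfl⟩ := exists_entries hA
    rw [extendZero_entries]; rfl
  smul_mem' c f hf := by
    refine ContDiffOn.congr (ContDiffOn.mul (contDiffOn_const (c := c)) hf) fun A hA => ?_
    obtain ⟨x, rfl⟩ := exists_entries hA
    rw [extendZero_entries, extendZero_entries]; rfl

/-- `R_X` as an operator on `C^∞(G)`, for a real matrix `X`. -/
def rightOpReal (X : Matrix (Fin n) (Fin n) ℝ) : Module.End ℂ (smoothFun n) where
  toFun f := ⟨rightDeriv X f.1, IsSmooth.rightDeriv f.2 X⟩
  map_add' f f' := by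
    ext g
    have h := (hasDerivAt_right f.2 X g).add (hasDerivAt_right f'.2 X g)
    have h' := rightDeriv_eq f.2 X g
    have h'' := rightDeriv_eq f'.2 X g
    change rightDeriv X (f.1 + f'.1) g = rightDeriv X f.1 g + rightDeriv X f'.1 g
    rw [h', h'']
    exact h.deriv
  map_smul' c f := by
    ext g
    have h := (hasDerivAt_right f.2 X g).const_mul c
    have h' := rightDeriv_eq f.2 X g
    change rightDeriv X (c • f.1) g = c * rightDeriv X f.1 g
    rw [h']
    exact h.deriv

theorem rightOpReal_apply (X : Matrix (Fin n) (Fin n) ℝ) (f : smoothFun n) (g : GL (Fin n) ℝ) :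
    (rightOpReal X f).1 g = rightDeriv X f.1 g := rfl

theorem rightOpReal_add (X Y : Matrix (Fin n) (Fin n) ℝ) :
    rightOpReal (X + Y) = rightOpReal X + rightOpReal Y := by
  ext f g
  change rightDeriv (X + Y) f.1 g = rightDeriv X f.1 g + rightDeriv Y f.1 g
  have h : mulR (X + Y) (entries g) = mulR X (entries g) + mulR Y (entries g) := by
    simp only [mulR_apply, mul_add]; rfl
  rw [rightDeriv_eq f.2, rightDeriv_eq f.2, rightDeriv_eq f.2, h, map_add]

theorem rightOpReal_smul (c : ℝ) (X : Matrix (Fin n) (Fin n) ℝ) :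
    rightOpReal (c • X) = (c : ℂ) • rightOpReal X := by
  ext f g
  change rightDeriv (c • X) f.1 g = (c : ℂ) * rightDeriv X f.1 g
  have h : mulR (c • X) (entries g) = c • mulR X (entries g) := by
    simp only [mulR_apply, Matrix.mul_smul]; rfl
  rw [rightDeriv_eq f.2, rightDeriv_eq f.2, h, map_smul, Complex.real_smul]

theorem rightOpReal_sub (X Y : Matrix (Fin n) (Fin n) ℝ) :
    rightOpReal (X - Y) = rightOpReal X - rightOpReal Y := by
  ext f g
  have h : mulR (X - Y) (entries g) = mulR X (entries g) - mulR Y (entries g) := by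
    simp only [mulR_apply, mul_sub]; rfl
  change rightDeriv (X - Y) f.1 g = rightDeriv X f.1 g - rightDeriv Y f.1 g
  rw [rightDeriv_eq f.2, rightDeriv_eq f.2, rightDeriv_eq f.2, h, map_sub]

theorem complex_bracket {E : Type*} [Ring E] [Algebra ℂ E] (A B C D : E) :
    (A * C - C * A) - (B * D - D * B) + Complex.I • ((A * D - D * A) + (B * C - C * B))
      = (A + Complex.I • B) * (C + Complex.I • D) - (C + Complex.I • D) * (A + Complex.I • B) := by
  have hI : ∀ T : E, Complex.I • Complex.I • T = -T := fun T => by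
    rw [smul_smul, Complex.I_mul_I, neg_one_smul]
  simp only [add_mul, mul_add, smul_mul_assoc, mul_smul_comm, hI, smul_add]
  module

theorem rightOpReal_lie (X Y : Matrix (Fin n) (Fin n) ℝ) :
    rightOpReal (X * Y - Y * X) = rightOpReal X * rightOpReal Y - rightOpReal Y * rightOpReal X := by
  ext f g
  exact rightDeriv_lie f.2 X Y g

/-- The complex linear extension of `X ↦ R_X` to `𝔤_ℂ = 𝔤𝔩(n, ℂ)`:
`R_{X + iY} = R_X + i R_Y` for real matrices `X`, `Y`. It is a homomorphism of Lie algebras. -/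
def rightOp (n : ℕ) : Matrix (Fin n) (Fin n) ℂ →ₗ⁅ℂ⁆ Module.End ℂ (smoothFun n) where
  toFun Z := rightOpReal (Z.map Complex.re) + Complex.I • rightOpReal (Z.map Complex.im)
  map_add' Z W := by
    have h1 : (Z + W).map Complex.re = Z.map Complex.re + W.map Complex.re := by
      ext; simp
    have h2 : (Z + W).map Complex.im = Z.map Complex.im + W.map Complex.im := by
      ext; simp
    rw [h1, h2, rightOpReal_add, rightOpReal_add, smul_add]
    abel
  map_smul' c Z := by
    have h1 : (c • Z).map Complex.re
        = c.re • Z.map Complex.re + (-c.im) • Z.map Complex.im := by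
      ext; simp; ring
    have h2 : (c • Z).map Complex.im
        = c.re • Z.map Complex.im + c.im • Z.map Complex.re := by
      ext; simp
    rw [h1, h2]
    simp only [rightOpReal_add, rightOpReal_smul, RingHom.id_apply]
    conv_rhs => rw [← Complex.re_add_im c]
    simp only [smul_add, add_smul, smul_smul, Complex.ofReal_neg, add_mul]
    have hI : (c.im : ℂ) * Complex.I * Complex.I = -(c.im : ℂ) := by
      rw [mul_assoc, Complex.I_mul_I]; ring
    rw [hI, mul_comm Complex.I (c.re : ℂ), mul_comm Complex.I (c.im : ℂ)]
    abel
  map_lie' {Z W} := by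
    have h1 : (Z * W - W * Z).map Complex.re
        = (Z.map Complex.re * W.map Complex.re - W.map Complex.re * Z.map Complex.re)
          - (Z.map Complex.im * W.map Complex.im
            - W.map Complex.im * Z.map Complex.im) := by
      ext
      simp [Matrix.mul_apply, Complex.mul_re, Finset.sum_sub_distrib]
      ring
    have h2 : (Z * W - W * Z).map Complex.im
        = (Z.map Complex.re * W.map Complex.im - W.map Complex.im * Z.map Complex.re)
          + (Z.map Complex.im * W.map Complex.re - W.map Complex.re * Z.map Complex.im) := by
      ext
      simp [Matrix.mul_apply, Complex.mul_im, Finset.sum_add_distrib]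
      ring
    change rightOpReal ((Z * W - W * Z).map Complex.re)
      + Complex.I • rightOpReal ((Z * W - W * Z).map Complex.im) = _
    rw [h1, h2, LieRing.of_associative_ring_bracket]
    rw [rightOpReal_add, rightOpReal_sub]
    simp only [rightOpReal_lie]
    exact complex_bracket (rightOpReal (Z.map Complex.re)) (rightOpReal (Z.map Complex.im))
      (rightOpReal (W.map Complex.re)) (rightOpReal (W.map Complex.im))

end RightAction

/-- `U(𝔤)`, the universal enveloping algebra of `𝔤_ℂ = 𝔤𝔩(n, ℂ)`. -/
abbrev Ug (n : ℕ) : Type := UniversalEnvelopingAlgebra ℂ (Matrix (Fin n) (Fin n) ℂ)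

/-- The action `D ↦ R_D` of `U(𝔤)` on `C^∞(G)` by right differentiation. -/
def rightAction (n : ℕ) : Ug n →ₐ[ℂ] Module.End ℂ (smoothFun n) :=
  UniversalEnvelopingAlgebra.lift ℂ (rightOp n)

/-! ## The annihilator ideal of a degenerate principal series representation -/

/-- `Ad(g) : 𝔤_ℂ → 𝔤_ℂ`, `X ↦ g X g⁻¹`, for `g ∈ GL(n, ℝ)`. -/
def adLie {n : ℕ} (g : GL (Fin n) ℝ) :
    Matrix (Fin n) (Fin n) ℂ →ₗ⁅ℂ⁆ Matrix (Fin n) (Fin n) ℂ where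
  toFun X := (g : Matrix (Fin n) (Fin n) ℝ).map Complex.ofReal * X *
    ((g⁻¹ : GL (Fin n) ℝ) : Matrix (Fin n) (Fin n) ℝ).map Complex.ofReal
  map_add' X Y := by rw [mul_add, add_mul]
  map_smul' c X := by simp
  map_lie' {X Y} := by
    have h : ((g⁻¹ : GL (Fin n) ℝ) : Matrix (Fin n) (Fin n) ℝ).map Complex.ofReal
        * (g : Matrix (Fin n) (Fin n) ℝ).map Complex.ofReal = 1 := by
      have h0 : ((g⁻¹ : GL (Fin n) ℝ) : Matrix (Fin n) (Fin n) ℝ)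
        * (g : Matrix (Fin n) (Fin n) ℝ) = 1 := g.inv_mul
      have h1 := congrArg (fun M : Matrix (Fin n) (Fin n) ℝ => M.map Complex.ofRealHom) h0
      rw [Matrix.map_mul, Matrix.map_one _ (map_zero _) (map_one _)] at h1
      exact h1
    simp only [LieRing.of_associative_ring_bracket, mul_sub, sub_mul]
    congr 1 <;>
    · simp only [mul_assoc]
      rw [← mul_assoc (Matrix.map _ _) (Matrix.map (g : Matrix (Fin n) (Fin n) ℝ) _), h, one_mul]

/-- The extension of `Ad(g)` to an algebra endomorphism of `U(𝔤)`. -/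
def adU {n : ℕ} (g : GL (Fin n) ℝ) : Ug n →ₐ[ℂ] Ug n :=
  UniversalEnvelopingAlgebra.lift ℂ
    ((UniversalEnvelopingAlgebra.ι ℂ : Matrix (Fin n) (Fin n) ℂ →ₗ⁅ℂ⁆ Ug n).comp (adLie g))

/-- The complexified Lie algebra of the lower block triangular parabolic subgroup `P_Θ`. The blocks
are given by `b : Fin n → Fin L`: the index `i` lies in the block number `b i`. -/
def parabolicLie {n L : ℕ} (b : Fin n → Fin L) : Submodule ℂ (Matrix (Fin n) (Fin n) ℂ) where
  carrier := {X | ∀ i j, b i < b j → X i j = 0}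
  add_mem' {X Y} hX hY i j h := by simp [hX i j h, hY i j h]
  zero_mem' i j _ := rfl
  smul_mem' c X hX i j h := by simp [hX i j h]

/-- The differential of the character `p ↦ ∏_m |det p_m| ^ λ_m` of `P_Θ`, where `p_m` denotes the
`m`-th diagonal block of `p`: it is `dλ(X) = ∑_m λ_m tr(X_m) = ∑_i λ_{b i} X_{ii}`. -/
def dChar {n L : ℕ} (b : Fin n → Fin L) (lam : Fin L → ℂ) (X : Matrix (Fin n) (Fin n) ℂ) : ℂ :=
  ∑ i, lam (b i) * X i i

/-- The left ideal `J_Θ(dλ) = ∑_{X ∈ 𝔭_Θ} U(𝔤) (X - dλ(X))`. -/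
def leftIdealJ {n L : ℕ} (b : Fin n → Fin L) (lam : Fin L → ℂ) : Ideal (Ug n) :=
  Ideal.span {D | ∃ X ∈ parabolicLie b,
    D = UniversalEnvelopingAlgebra.ι ℂ X - algebraMap ℂ (Ug n) (dChar b lam X)}

/-- The annihilator ideal `I_Θ(λ) = ⋂_{g ∈ G} Ad(g) J_Θ(dλ)`. -/
def annIdeal {n L : ℕ} (b : Fin n → Fin L) (lam : Fin L → ℂ) : Set (Ug n) :=
  ⋂ g : GL (Fin n) ℝ, adU g '' (leftIdealJ b lam : Set (Ug n))

/-- The two blocks `{1, …, k}` and `{k + 1, …, 4}` of the maximal parabolic subgroup `P_{k,4}`. -/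
def twoBlocks (k : ℕ) (i : Fin 4) : Fin 2 := if (i : ℕ) < k then 0 else 1

/-- The ideal `I_k(λ) = I_{{k, 4}}(λ)` of `U(𝔤𝔩(4, ℂ))`, with `λ = (λ₁, λ₂)`. -/
def idealI (k : ℕ) (lam₁ lam₂ : ℂ) : Set (Ug 4) := annIdeal (twoBlocks k) ![lam₁, lam₂]

/-! ## Generalized Whittaker functions on `GL(4, ℝ)` -/

/-- The element `n(z, y₁, y₂, x₁, x₂, x₃)` of the Lie algebra `𝔫`. -/
def nMat (z y₁ y₂ x₁ x₂ x₃ : ℝ) : Matrix (Fin 4) (Fin 4) ℝ :=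
  !![0, 0, 0, 0;
     x₁, 0, 0, 0;
     y₁, x₂, 0, 0;
     z, y₂, x₃, 0]

/-- The linear form `l(α, β₁, β₂, γ₁, γ₂, γ₃)` on `𝔫`, as a strictly upper triangular matrix acting
on `𝔫` through the trace form. -/
def lMat (α β₁ β₂ γ₁ γ₂ γ₃ : ℝ) : Matrix (Fin 4) (Fin 4) ℝ :=
  !![0, γ₁, β₁, α;
     0, 0, γ₂, β₂;
     0, 0, 0, γ₃;
     0, 0, 0, 0]

/-- The subalgebra `𝔰_(II) = ℝ X₁ + ℝ X₃ + ℝ Y₁ + ℝ Y₂ + ℝ Z` of `𝔫`. -/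
def sII : Submodule ℝ (Matrix (Fin 4) (Fin 4) ℝ) :=
  Submodule.span ℝ {nMat 0 0 0 1 0 0, nMat 0 0 0 0 0 1, nMat 0 1 0 0 0 0, nMat 0 0 1 0 0 0,
    nMat 1 0 0 0 0 0}

/-- The space `C^∞_{χ_l}(S \ G / K; I)` for `G = GL(4, ℝ)`, `K = O(4)`, `S = exp 𝔰` and
`χ_l(exp X) = e^{2πi l(X)}` for `X ∈ 𝔰`, where `l(X) = tr(l X)`: the smooth functions `f` on `G` with
`f(s g k) = χ_l(s) f(g)` for `s ∈ S`, `g ∈ G`, `k ∈ K`, and `R_D f = 0` for all `D ∈ I`. -/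
def whittakerSpace (s : Submodule ℝ (Matrix (Fin 4) (Fin 4) ℝ)) (l : Matrix (Fin 4) (Fin 4) ℝ)
    (I : Set (Ug 4)) : Submodule ℂ (smoothFun 4) where
  carrier := {f |
    (∀ X ∈ s, ∀ g k : GL (Fin 4) ℝ,
      (k : Matrix (Fin 4) (Fin 4) ℝ) ∈ Matrix.orthogonalGroup (Fin 4) ℝ →
      f.1 (expGL X * g * k)
        = Complex.exp (2 * Real.pi * Complex.I * ((l * X).trace : ℝ)) * f.1 g) ∧
    ∀ D ∈ I, rightAction 4 D f = 0}
  add_mem' {f f'} hf hf' := by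
    refine ⟨fun X hX g k hk => ?_, fun D hD => ?_⟩
    · have h1 := hf.1 X hX g k hk
      have h2 := hf'.1 X hX g k hk
      change f.1 _ + f'.1 _ = _ * (f.1 g + f'.1 g)
      rw [h1, h2, mul_add]
    · rw [map_add, hf.2 D hD, hf'.2 D hD, add_zero]
  zero_mem' := ⟨fun X _ g k _ => by
    change (0 : ℂ) = _ * (0 : ℂ)
    rw [mul_zero], fun D _ => map_zero _⟩
  smul_mem' c f hf := by
    refine ⟨fun X hX g k hk => ?_, fun D hD => ?_⟩
    · have h1 := hf.1 X hX g k hk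
      change c * f.1 _ = _ * (c * f.1 g)
      rw [h1]
      ring
    · rw [map_smul, hf.2 D hD, smul_zero]

/-- The element `diag(a₁, a₂, a₃, a₄)` of `A`, for `a₁, …, a₄ > 0`. -/
def diagGL (a : Fin 4 → Set.Ioi (0 : ℝ)) : GL (Fin 4) ℝ where
  val := Matrix.diagonal fun i => (a i : ℝ)
  inv := Matrix.diagonal fun i => (a i : ℝ)⁻¹
  val_inv := by
    rw [Matrix.diagonal_mul_diagonal, ← Matrix.diagonal_one]
    congr 1; funext i
    exact mul_inv_cancel₀ (ne_of_gt (a i).2)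
  inv_val := by
    rw [Matrix.diagonal_mul_diagonal, ← Matrix.diagonal_one]
    congr 1; funext i
    exact inv_mul_cancel₀ (ne_of_gt (a i).2)

/-- The map `Ξ_(II)`, in the coordinates `(u, a) ↦ exp(u X₂) × diag(a)` of `S_(II) \ N × A`:
`Ξ_(II)(f)(u, a) = f(exp(u X₂) diag(a))`. -/
def xiII : smoothFun 4 →ₗ[ℂ] (ℝ × (Fin 4 → Set.Ioi (0 : ℝ)) → ℂ) where
  toFun f p := f.1 (expGL (p.1 • nMat 0 0 0 0 1 0) * diagGL p.2)
  map_add' _ _ := rfl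
  map_smul' _ _ := rfl

end GenWhittaker

end

open scoped Matrix ContDiff

noncomputable section

namespace GenWhittaker

attribute [local instance 100] LieRing.ofAssociativeRing

/-! ## Quadratic elements of the annihilator ideal -/

/-! Let `E = (E_{ij})` be the matrix of generators with entries in `U(𝔤)`. For a two-block parabolic
it satisfies, modulo `J(λ)`, the quadratic equation `(E - λ₁)(E - λ₂ - N) = 0`. Conjugation by `g`
replaces the entries of this polynomial by linear combinations of one another, so they lie in every
`Ad(g) J(λ)`, hence in the annihilator ideal (`quadU_mem_annIdeal`).

At the point `g`, right differentiation along `Ad(g⁻¹)X` is differentiation of `f(exp(tX) g)`, so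
each entry of the equation yields a relation between left derivatives of `f`
(`rightAction_quadU_conj`). In the corner entry `∑_j E_{4j} E_{j1} - c E_{41}`, left equivariance
under `S_(II)` determines everything. `E_{41}` and `E_{43}` act by zero, and moving `E_{41}` in
front of `E_{44}` only produces another `E_{41}`. The single surviving term is `E_{42} E_{21}`,
which acts by `(2πi)²`. Hence `(2πi)² f(g) = 0` for every `g`. -/

/-- The matrix unit `E_{ij}` as an element of `U(𝔤)`. -/
def eU {n : ℕ} (i j : Fin n) : Ug n :=
  UniversalEnvelopingAlgebra.ι ℂ (Matrix.single i j (1 : ℂ))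

/-- The `(i, k)` entry of the matrix `E² - c E + d` with entries in `U(𝔤)`, where `E = (E_{ij})`. -/
def quadU {n : ℕ} (c d : ℂ) (i k : Fin n) : Ug n :=
  ∑ j, eU i j * eU j k - c • eU i k + (if i = k then d else 0) • (1 : Ug n)

theorem ι_eq_sum {n : ℕ} (X : Matrix (Fin n) (Fin n) ℂ) :
    (UniversalEnvelopingAlgebra.ι ℂ X : Ug n) = ∑ p, ∑ q, X p q • eU p q := by
  conv_lhs => rw [Matrix.matrix_eq_sum_single X]
  simp only [map_sum, eU, ← map_smul, Matrix.smul_single, smul_eq_mul, mul_one]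

theorem eU_commutator {n : ℕ} (i j k : Fin n) :
    eU i j * eU j k - eU j k * eU i j = eU i k - (if i = k then 1 else 0 : ℂ) • eU j j := by
  have h : (UniversalEnvelopingAlgebra.ι ℂ
      ⁅Matrix.single i j (1 : ℂ), Matrix.single j k (1 : ℂ)⁆ : Ug n)
      = eU i j * eU j k - eU j k * eU i j := by
    rw [LieHom.map_lie, LieRing.of_associative_ring_bracket]
    rfl
  rw [← h, LieRing.of_associative_ring_bracket, map_sub, Matrix.single_mul_single_same, mul_one]
  by_cases hik : i = k
  · subst hik
    simp [eU]
  · rw [Matrix.single_mul_single_of_ne _ _ _ _ (Ne.symm hik)]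
    simp [eU, hik]

theorem single_mem_parabolicLie {n L : ℕ} {b : Fin n → Fin L} {i j : Fin n} (h : ¬ b i < b j) :
    Matrix.single i j (1 : ℂ) ∈ parabolicLie b := by
  intro p q hpq
  rw [Matrix.single_apply, if_neg]
  rintro ⟨rfl, rfl⟩
  exact h hpq

theorem dChar_single {n L : ℕ} (b : Fin n → Fin L) (lam : Fin L → ℂ) (i j : Fin n) :
    dChar b lam (Matrix.single i j 1) = if i = j then lam (b i) else 0 := by
  unfold dChar
  by_cases h : i = j
  · subst h
    rw [Finset.sum_eq_single i] <;> simp +contextual [eq_comm]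
  · rw [if_neg h]
    refine Finset.sum_eq_zero fun p _ => ?_
    rw [Matrix.single_apply, if_neg, mul_zero]
    rintro ⟨rfl, rfl⟩
    exact h rfl

theorem smul_mem_leftIdealJ {n L : ℕ} {b : Fin n → Fin L} {lam : Fin L → ℂ} {x : Ug n}
    (c : ℂ) (hx : x ∈ leftIdealJ b lam) : c • x ∈ leftIdealJ b lam := by
  rw [Algebra.smul_def]
  exact Ideal.mul_mem_left _ _ hx

theorem eU_sub_mem_leftIdealJ {n L : ℕ} {b : Fin n → Fin L} (lam : Fin L → ℂ) {i j : Fin n}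
    (h : ¬ b i < b j) :
    eU i j - (if i = j then lam (b i) else 0) • (1 : Ug n) ∈ leftIdealJ b lam := by
  refine Ideal.subset_span ⟨_, single_mem_parabolicLie h, ?_⟩
  rw [dChar_single, Algebra.algebraMap_eq_smul_one]
  rfl

/-- For a parabolic subalgebra with two blocks, the first one of size `N`, the entries of
`(E - λ₁) (E - λ₂ - N)` lie in the left ideal `J(λ)`. -/
theorem quadU_mem_leftIdealJ {n N : ℕ} (b : Fin n → Fin 2) (lam : Fin 2 → ℂ)
    (hN : (Finset.univ.filter fun j => b j = 0).card = N) (i k : Fin n) :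
    quadU (lam 0 + lam 1 + N) (lam 0 * (lam 1 + N)) i k ∈ leftIdealJ b lam := by
  set J := leftIdealJ b lam with hJ
  have hmk : ∀ {p q : Fin n}, ¬ b p < b q → ∀ x : Ug n,
      x * eU p q - (if p = q then lam (b p) else 0) • x ∈ J := by
    intro p q h x
    have := Ideal.mul_mem_left J x (eU_sub_mem_leftIdealJ lam h)
    rwa [mul_sub, mul_smul_comm, mul_one] at this
  have htwo : ∀ x : Fin 2, x = 0 ∨ x = 1 := by decide
  -- Column `k` in the first block: every `E_{jk}` lies in `𝔭`, so the right factors can be replaced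
  -- by scalars at once.
  rcases htwo (b k) with hk | hk
  · have h1 : ∑ j, eU i j * eU j k - lam 0 • eU i k ∈ J := by
      have : ∑ j, (eU i j * eU j k - (if j = k then lam (b j) else 0) • eU i j) ∈ J :=
        J.sum_mem fun j _ => hmk (by rw [hk]; exact not_lt_of_ge (Fin.zero_le _)) _
      simpa [Finset.sum_sub_distrib, ite_smul, hk] using this
    have h2 : eU i k - (if i = k then lam (b i) else 0) • (1 : Ug n) ∈ J :=
      eU_sub_mem_leftIdealJ lam (by rw [hk]; exact not_lt_of_ge (Fin.zero_le _))
    -- `E²` has become `λ₁ E`, so the polynomial reduces to `-(λ₂ + N)(E - λ₁)`, whose entry is a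
    -- multiple of `h2`.
    have h3 := J.add_mem h1 (smul_mem_leftIdealJ (-(lam 1 + N)) h2)
    convert h3 using 1
    unfold quadU
    by_cases hik : i = k
    · subst hik
      simp only [if_true, hk]
      module
    · simp only [hik, if_false]
      module
  -- Column `k` in the second block: for `j` in the first block `E_{jk}` is not in `𝔭`, but `E_{ij}`
  -- is. Exchanging the two factors costs `E_{ik} - δ_{ik} E_{jj}`, and `E_{jj}` is congruent to
  -- `λ₁`. Each such `j` thus contributes once to the shift by `N`.
  · have h1 : ∀ j, eU i j * eU j k
        - ((if b j = 1 ∧ j = k then lam 1 else 0) • eU i k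
          + (if b j = 0 ∧ i = j then lam 0 else 0) • eU i k
          + (if b j = 0 then (1 : ℂ) else 0) •
            (eU i k - (if i = k then lam 0 else 0) • (1 : Ug n))) ∈ J := by
      intro j
      rcases htwo (b j) with hj | hj
      · have a1 := hmk (p := i) (q := j) (by rw [hj]; exact not_lt_of_ge (Fin.zero_le _)) (eU j k)
        have a2 := smul_mem_leftIdealJ (-(if i = k then 1 else 0))
          (eU_sub_mem_leftIdealJ lam (b := b) (i := j) (j := j) (lt_irrefl _))
        have a3 := J.add_mem a1 a2
        convert a3 using 1
        have hc := eU_commutator i j k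
        rw [sub_eq_iff_eq_add] at hc
        rw [hc]
        by_cases hij : i = j
        · subst hij
          by_cases hik : i = k
          · subst hik; simp [hj] at hk
          · simp only [hj, hik]
            simp
            abel
        · by_cases hik : i = k
          · subst hik
            simp only [hj, hij]
            simp
            module
          · simp only [hj, hij, hik]
            simp
      · have a1 := hmk (p := j) (q := k) (by rw [hj, hk]; exact lt_irrefl _) (eU i j)
        convert a1 using 1
        by_cases hjk : j = k
        · subst hjk; simp [hj]
        · simp [hj, hjk]
    have h2 := J.sum_mem fun j (_ : j ∈ Finset.univ) => h1 j
    have e1 : ∑ j, (if b j = 1 ∧ j = k then lam 1 else 0) = lam 1 := by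
      rw [Finset.sum_eq_single k] <;> simp +contextual [hk]
    have e2 : ∑ j, (if b j = 0 ∧ i = j then lam 0 else 0) = if b i = 0 then lam 0 else 0 := by
      rw [Finset.sum_eq_single i] <;> simp +contextual [eq_comm]
    have e3 : ∑ j, (if b j = 0 then (1 : ℂ) else 0) = N := by
      rw [Finset.sum_boole, hN]
    rw [Finset.sum_sub_distrib, Finset.sum_add_distrib, Finset.sum_add_distrib,
      ← Finset.sum_smul, ← Finset.sum_smul, ← Finset.sum_smul, e1, e2, e3] at h2
    -- If `i` is in the first block, then `i ≠ k` and the sum is already `c E_{ik}`. Otherwise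
    -- `-λ₁(E_{ik} - δ_{ik} λ₂)` remains, which is in `J` because `E_{ik}` lies in `𝔭`.
    rcases htwo (b i) with hi | hi
    · have hik : i ≠ k := by rintro rfl; simp [hi] at hk
      convert h2 using 1
      unfold quadU
      simp only [hi, hik, if_true, if_false]
      module
    · have h3 : eU i k - (if i = k then lam (b i) else 0) • (1 : Ug n) ∈ J :=
        eU_sub_mem_leftIdealJ lam (by rw [hk, hi]; exact lt_irrefl _)
      have h4 := J.add_mem h2 (smul_mem_leftIdealJ (-lam 0) h3)
      convert h4 using 1
      unfold quadU
      by_cases hik : i = k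
      · subst hik
        simp only [hi, if_true, one_ne_zero, if_false]
        module
      · simp only [hi, hik, one_ne_zero, if_false]
        module

/-! ## Invariance under the adjoint action -/

theorem coe_mul_coe_inv {n : ℕ} (g : GL (Fin n) ℝ) (r q : Fin n) :
    ∑ j, (((g⁻¹ : GL (Fin n) ℝ).val j q : ℝ) : ℂ) * ((g.val r j : ℝ) : ℂ)
      = if r = q then 1 else 0 := by
  have h := congrFun (congrFun (g.mul_inv) r) q
  rw [Matrix.mul_apply, Matrix.one_apply] at h
  have h' := congrArg Complex.ofReal h
  rw [Complex.ofReal_sum] at h'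
  simp only [Complex.ofReal_mul] at h'
  simp only [mul_comm (((g⁻¹ : GL (Fin n) ℝ).val _ q : ℝ) : ℂ)]
  refine h'.trans ?_
  split_ifs <;> simp

theorem adU_ι {n : ℕ} (g : GL (Fin n) ℝ) (X : Matrix (Fin n) (Fin n) ℂ) :
    adU g (UniversalEnvelopingAlgebra.ι ℂ X) = UniversalEnvelopingAlgebra.ι ℂ (adLie g X) := by
  unfold adU
  rw [UniversalEnvelopingAlgebra.lift_ι_apply]
  rfl

theorem adU_eU {n : ℕ} (g : GL (Fin n) ℝ) (i j : Fin n) :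
    adU g (eU i j) = ∑ p, ∑ q,
      (((g.val p i : ℝ) : ℂ) * (((g⁻¹ : GL (Fin n) ℝ).val j q : ℝ) : ℂ)) • eU p q := by
  have h : ∀ p q, adLie g (Matrix.single i j 1) p q
      = ((g.val p i : ℝ) : ℂ) * (((g⁻¹ : GL (Fin n) ℝ).val j q : ℝ) : ℂ) := by
    intro p q
    change ((g : Matrix (Fin n) (Fin n) ℝ).map Complex.ofReal * Matrix.single i j (1 : ℂ) *
      ((g⁻¹ : GL (Fin n) ℝ) : Matrix (Fin n) (Fin n) ℝ).map Complex.ofReal :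
        Matrix (Fin n) (Fin n) ℂ) p q = _
    rw [Matrix.mul_apply, Finset.sum_eq_single j]
    · simp
    · intro m _ hm
      rw [Matrix.mul_single_apply_of_ne _ _ _ _ _ hm, zero_mul]
    · simp
  rw [eU, adU_ι, ι_eq_sum]
  simp only [h]

/-- `Ad(g)` acts on `E` through scalar matrices on both sides, inverse to each other up to
transposition. In the product the inner pair cancels, so `E²`, `E` and the identity all transform by
the same rule. -/
theorem adU_quadU {n : ℕ} (g : GL (Fin n) ℝ) (c d : ℂ) (i k : Fin n) :
    adU g (quadU c d i k) = ∑ p, ∑ s,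
      (((g.val p i : ℝ) : ℂ) * (((g⁻¹ : GL (Fin n) ℝ).val k s : ℝ) : ℂ)) • quadU c d p s := by
  have h1 : ∑ j, adU g (eU i j) * adU g (eU j k) = ∑ p, ∑ s,
      (((g.val p i : ℝ) : ℂ) * (((g⁻¹ : GL (Fin n) ℝ).val k s : ℝ) : ℂ)) •
        ∑ q, eU p q * eU q s := by
    calc _ = ∑ j, ∑ p, ∑ q, ∑ r, ∑ s,
          ((((g⁻¹ : GL (Fin n) ℝ).val j q : ℝ) : ℂ) * ((g.val r j : ℝ) : ℂ)) •
            (((g.val p i : ℝ) : ℂ) * (((g⁻¹ : GL (Fin n) ℝ).val k s : ℝ) : ℂ)) •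
              (eU p q * eU r s) := by
          refine Finset.sum_congr rfl fun j _ => ?_
          simp only [adU_eU, Finset.sum_mul]
          refine Finset.sum_congr rfl fun p _ => Finset.sum_congr rfl fun q _ => ?_
          simp only [Finset.mul_sum]
          refine Finset.sum_congr rfl fun r _ => Finset.sum_congr rfl fun s _ => ?_
          rw [smul_mul_smul_comm, smul_smul]
          congr 1
          ring
      _ = ∑ p, ∑ q, ∑ r, ∑ s, (if r = q then 1 else 0 : ℂ) •
            (((g.val p i : ℝ) : ℂ) * (((g⁻¹ : GL (Fin n) ℝ).val k s : ℝ) : ℂ)) •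
              (eU p q * eU r s) := by
          -- The sum over `j` is carried inwards past `p`, `q`, `r`, `s`, until only the entry of `g
          -- g⁻¹` depends on `j`.
          rw [Finset.sum_comm]
          refine Finset.sum_congr rfl fun p _ => ?_
          rw [Finset.sum_comm]
          refine Finset.sum_congr rfl fun q _ => ?_
          rw [Finset.sum_comm]
          refine Finset.sum_congr rfl fun r _ => ?_
          rw [Finset.sum_comm]
          refine Finset.sum_congr rfl fun s _ => ?_
          rw [← Finset.sum_smul, coe_mul_coe_inv]
      _ = _ := by
          refine Finset.sum_congr rfl fun p _ => ?_
          have : ∀ q, ∑ r, ∑ s, (if r = q then 1 else 0 : ℂ) •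
              (((g.val p i : ℝ) : ℂ) * (((g⁻¹ : GL (Fin n) ℝ).val k s : ℝ) : ℂ)) •
                (eU p q * eU r s) = ∑ s,
              (((g.val p i : ℝ) : ℂ) * (((g⁻¹ : GL (Fin n) ℝ).val k s : ℝ) : ℂ)) •
                (eU p q * eU q s) := by
            intro q
            rw [Finset.sum_eq_single q] <;> simp +contextual
          simp only [this]
          rw [Finset.sum_comm]
          simp only [Finset.smul_sum]
  have h2 : ∑ p, ∑ s,
      (((g.val p i : ℝ) : ℂ) * (((g⁻¹ : GL (Fin n) ℝ).val k s : ℝ) : ℂ)) •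
        (if p = s then d else 0) • (1 : Ug n) = (if i = k then d else 0) • (1 : Ug n) := by
    have h3 := coe_mul_coe_inv g⁻¹ k i
    rw [inv_inv] at h3
    have h4 : ∀ p, ∑ s, (((g.val p i : ℝ) : ℂ) * (((g⁻¹ : GL (Fin n) ℝ).val k s : ℝ) : ℂ)) •
        (if p = s then d else 0) • (1 : Ug n)
        = (((g.val p i : ℝ) : ℂ) * (((g⁻¹ : GL (Fin n) ℝ).val k p : ℝ) : ℂ)) • d • (1 : Ug n) := by
      intro p
      rw [Finset.sum_eq_single p] <;> simp +contextual [eq_comm]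
    simp only [h4]
    rw [← Finset.sum_smul, h3]
    simp [eq_comm, ite_smul]
  simp only [quadU, map_add, map_sub, map_sum, map_mul, map_smul, map_one, smul_add, smul_sub,
    Finset.sum_add_distrib, Finset.sum_sub_distrib]
  rw [h1, h2, adU_eU]
  simp only [Finset.smul_sum, smul_comm c]

/-- The span of the entries of `E² - c E + d` is stable under `Ad(g)`, and `Ad(g)` maps this span
onto itself. -/
theorem quadU_eq_adU {n : ℕ} (g : GL (Fin n) ℝ) (c d : ℂ) (i k : Fin n) :
    adU g (∑ p, ∑ s, ((((g⁻¹ : GL (Fin n) ℝ).val p i : ℝ) : ℂ) * ((g.val k s : ℝ) : ℂ)) •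
      quadU c d p s) = quadU c d i k := by
  have h : ∀ x : Ug n, adU g (adU g⁻¹ x) = x := by
    intro x
    have : (adU g).comp (adU g⁻¹) = AlgHom.id ℂ (Ug n) := by
      apply UniversalEnvelopingAlgebra.hom_ext
      ext1 X
      change adU g (adU g⁻¹ (UniversalEnvelopingAlgebra.ι ℂ X)) = UniversalEnvelopingAlgebra.ι ℂ X
      rw [adU_ι, adU_ι]
      congr 1
      have hg : (g : Matrix (Fin n) (Fin n) ℝ).map Complex.ofReal *
          ((g⁻¹ : GL (Fin n) ℝ) : Matrix (Fin n) (Fin n) ℝ).map Complex.ofReal = 1 := by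
        have h1 := congrArg (fun M : Matrix (Fin n) (Fin n) ℝ => M.map Complex.ofRealHom) g.mul_inv
        rw [Matrix.map_mul, Matrix.map_one _ (map_zero _) (map_one _)] at h1
        exact h1
      change (g : Matrix (Fin n) (Fin n) ℝ).map Complex.ofReal *
        (((g⁻¹ : GL (Fin n) ℝ) : Matrix (Fin n) (Fin n) ℝ).map Complex.ofReal * X *
          (((g⁻¹)⁻¹ : GL (Fin n) ℝ) : Matrix (Fin n) (Fin n) ℝ).map Complex.ofReal) *
        ((g⁻¹ : GL (Fin n) ℝ) : Matrix (Fin n) (Fin n) ℝ).map Complex.ofReal = X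
      rw [inv_inv, mul_assoc, mul_assoc, mul_assoc, hg, mul_one, ← mul_assoc, hg, one_mul]
    exact DFunLike.congr_fun this x
  have h' := adU_quadU g⁻¹ c d i k
  rw [inv_inv] at h'
  rw [← h', h]

theorem quadU_mem_annIdeal {n N : ℕ} (b : Fin n → Fin 2) (lam : Fin 2 → ℂ)
    (hN : (Finset.univ.filter fun j => b j = 0).card = N) (i k : Fin n) :
    quadU (lam 0 + lam 1 + N) (lam 0 * (lam 1 + N)) i k ∈ annIdeal b lam := by
  refine Set.mem_iInter.2 fun g => ⟨_, ?_, quadU_eq_adU g _ _ i k⟩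
  exact Submodule.sum_mem _ fun p _ => Submodule.sum_mem _ fun s _ =>
    smul_mem_leftIdealJ _ (quadU_mem_leftIdealJ b lam hN p s)

/-! ## Right differentiation in the directions `Ad(g⁻¹) X` -/

/-- This moves a one-parameter group from the right of `g` to the left, where the equivariance under
`S_(II)` applies. -/
theorem mul_expGL_conj {n : ℕ} (g : GL (Fin n) ℝ) (X : Matrix (Fin n) (Fin n) ℝ) (t : ℝ) :
    g * expGL (t • ((g⁻¹ : GL (Fin n) ℝ).val * X * g.val)) = expGL (t • X) * g := by
  have h := Matrix.exp_units_conj' g (t • X)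
  apply Units.ext
  change g.val * NormedSpace.exp (t • ((g⁻¹ : GL (Fin n) ℝ).val * X * g.val))
    = NormedSpace.exp (t • X) * g.val
  have e : t • ((g⁻¹ : GL (Fin n) ℝ).val * X * g.val)
      = (g⁻¹ : GL (Fin n) ℝ).val * (t • X) * g.val := by
    rw [Matrix.mul_smul, Matrix.smul_mul]
  rw [e, h, ← mul_assoc, ← mul_assoc, g.mul_inv, one_mul]

theorem rightDeriv_conj {n : ℕ} (F : GL (Fin n) ℝ → ℂ) (g : GL (Fin n) ℝ)
    (X : Matrix (Fin n) (Fin n) ℝ) :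
    rightDeriv ((g⁻¹ : GL (Fin n) ℝ).val * X * g.val) F g
      = deriv (fun t : ℝ => F (expGL (t • X) * g)) 0 := by
  unfold rightDeriv
  simp only [mul_expGL_conj]

theorem rightDeriv_rightDeriv_conj {n : ℕ} (F : GL (Fin n) ℝ → ℂ) (g : GL (Fin n) ℝ)
    (X Y : Matrix (Fin n) (Fin n) ℝ) :
    rightDeriv ((g⁻¹ : GL (Fin n) ℝ).val * X * g.val)
        (rightDeriv ((g⁻¹ : GL (Fin n) ℝ).val * Y * g.val) F) g
      = deriv (fun t : ℝ => deriv (fun s : ℝ => F (expGL (t • X) * (expGL (s • Y) * g))) 0) 0 := by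
  rw [rightDeriv_conj]
  congr 1
  funext t
  unfold rightDeriv
  congr 1
  funext s
  rw [mul_assoc, mul_expGL_conj]

/-- Conjugation by `g` preserves commutators, so this is `rightDeriv_lie` transported to the left.
The outer derivative belongs to the factor farthest to the left, so operators keep their order. -/
theorem deriv_deriv_left_comm {n : ℕ} (f : smoothFun n) (g : GL (Fin n) ℝ)
    (X Y : Matrix (Fin n) (Fin n) ℝ) :
    deriv (fun t : ℝ => deriv (fun s : ℝ => f.1 (expGL (t • X) * (expGL (s • Y) * g))) 0) 0
      = deriv (fun t : ℝ => deriv (fun s : ℝ => f.1 (expGL (t • Y) * (expGL (s • X) * g))) 0) 0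
        + deriv (fun t : ℝ => f.1 (expGL (t • (X * Y - Y * X)) * g)) 0 := by
  have h : ∀ V W : Matrix (Fin n) (Fin n) ℝ, (g⁻¹ : GL (Fin n) ℝ).val * V * g.val *
      ((g⁻¹ : GL (Fin n) ℝ).val * W * g.val) = (g⁻¹ : GL (Fin n) ℝ).val * (V * W) * g.val := by
    intro V W
    calc _ = (g⁻¹ : GL (Fin n) ℝ).val * V * (g.val * (g⁻¹ : GL (Fin n) ℝ).val) * W * g.val := by
          simp only [mul_assoc]
      _ = _ := by rw [g.mul_inv, mul_one, mul_assoc _ V W]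
  rw [← rightDeriv_rightDeriv_conj, ← rightDeriv_rightDeriv_conj, ← rightDeriv_conj, mul_sub,
    sub_mul, ← h, ← h, rightDeriv_lie f.2]
  ring

theorem rightAction_adU_eU {n : ℕ} (g : GL (Fin n) ℝ) (i j : Fin n) :
    rightAction n (adU g⁻¹ (eU i j))
      = rightOpReal ((g⁻¹ : GL (Fin n) ℝ).val * Matrix.single i j (1 : ℝ) * g.val) := by
  have h : adLie g⁻¹ (Matrix.single i j (1 : ℂ))
      = ((g⁻¹ : GL (Fin n) ℝ).val * Matrix.single i j (1 : ℝ) * g.val).map Complex.ofRealHom := by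
    change ((g⁻¹ : GL (Fin n) ℝ) : Matrix (Fin n) (Fin n) ℝ).map Complex.ofReal *
      Matrix.single i j (1 : ℂ) *
        (((g⁻¹)⁻¹ : GL (Fin n) ℝ) : Matrix (Fin n) (Fin n) ℝ).map Complex.ofReal = _
    rw [inv_inv, Matrix.map_mul, Matrix.map_mul, Matrix.map_single, map_one]
    rfl
  rw [eU, adU_ι, h, rightAction, UniversalEnvelopingAlgebra.lift_ι_apply]
  set Y := (g⁻¹ : GL (Fin n) ℝ).val * Matrix.single i j (1 : ℝ) * g.val
  change rightOpReal ((Y.map Complex.ofRealHom).map Complex.re)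
    + Complex.I • rightOpReal ((Y.map Complex.ofRealHom).map Complex.im) = _
  have h1 : (Y.map Complex.ofRealHom).map Complex.re = Y := by ext; simp
  -- The zero imaginary part is written as a multiple of `Y` so that `rightOpReal_smul` removes it.
  have h2 : (Y.map Complex.ofRealHom).map Complex.im = (0 : ℝ) • Y := by ext; simp
  rw [h1, h2, rightOpReal_smul]
  simp

/-- Off the diagonal the constant `d` disappears, leaving only derivatives along matrix units acting
on the left. -/
theorem rightAction_quadU_conj {n : ℕ} (f : smoothFun n) (g : GL (Fin n) ℝ) (c d : ℂ)
    {i k : Fin n} (hik : i ≠ k) :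
    (rightAction n (adU g⁻¹ (quadU c d i k)) f).1 g
      = ∑ j, deriv (fun t : ℝ => deriv (fun s : ℝ =>
          f.1 (expGL (t • Matrix.single i j 1) * (expGL (s • Matrix.single j k 1) * g))) 0) 0
        - c * deriv (fun t : ℝ => f.1 (expGL (t • Matrix.single i k 1) * g)) 0 := by
  have hsum : ∀ F : Fin n → smoothFun n, (∑ j, F j).1 g = ∑ j, (F j).1 g := by
    intro F
    rw [Submodule.coe_sum, Finset.sum_apply]
  rw [quadU, if_neg hik, zero_smul, add_zero, map_sub, map_sub, map_sum, map_sum, map_smul,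
    map_smul, LinearMap.sub_apply, LinearMap.sum_apply, LinearMap.smul_apply]
  change (∑ j, rightAction n (adU g⁻¹ (eU i j * eU j k)) f).1 g
    - c * (rightAction n (adU g⁻¹ (eU i k)) f).1 g = _
  rw [hsum]
  simp only [map_mul, rightAction_adU_eU, Module.End.mul_apply, rightOpReal_apply]
  congr 1
  · refine Finset.sum_congr rfl fun j _ => ?_
    exact rightDeriv_rightDeriv_conj f.1 g _ _
  · rw [rightDeriv_conj]

/-! ## Vanishing of the Whittaker functions -/

theorem nMat_mem_sII (z y₁ y₂ x₁ x₃ : ℝ) : nMat z y₁ y₂ x₁ 0 x₃ ∈ sII := by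
  have h : nMat z y₁ y₂ x₁ 0 x₃ = x₁ • nMat 0 0 0 1 0 0 + x₃ • nMat 0 0 0 0 0 1
      + y₁ • nMat 0 1 0 0 0 0 + y₂ • nMat 0 0 1 0 0 0 + z • nMat 1 0 0 0 0 0 := by
    ext i j
    fin_cases i <;> fin_cases j <;> simp [nMat]
  rw [h]
  refine add_mem (add_mem (add_mem (add_mem ?_ ?_) ?_) ?_) ?_ <;>
    exact Submodule.smul_mem _ _ (Submodule.subset_span (by simp))

theorem trace_lMat_mul_nMat (α β₁ β₂ γ₁ γ₂ γ₃ z y₁ y₂ x₁ x₂ x₃ : ℝ) :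
    (lMat α β₁ β₂ γ₁ γ₂ γ₃ * nMat z y₁ y₂ x₁ x₂ x₃).trace
      = α * z + β₁ * y₁ + β₂ * y₂ + γ₁ * x₁ + γ₂ * x₂ + γ₃ * x₃ := by
  simp [lMat, nMat, Matrix.trace, Fin.sum_univ_four]
  ring

theorem deriv_cexp_mul_const (w z : ℂ) :
    deriv (fun t : ℝ => Complex.exp (w * (t : ℂ)) * z) 0 = w * z := by
  have h : HasDerivAt (fun t : ℝ => Complex.exp (w * (t : ℂ)) * z)
      (Complex.exp (w * ((0 : ℝ) : ℂ)) * (w * 1) * z) 0 :=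
    ((((Complex.ofRealCLM.hasDerivAt (x := (0 : ℝ))).const_mul w).cexp)).mul_const z
  rw [h.deriv]
  simp

theorem whittakerSpace_sII_eq_bot {I : Set (Ug 4)} {c d : ℂ}
    (hI : ∀ i k, quadU c d i k ∈ I) : whittakerSpace sII (lMat 0 0 1 1 0 0) I = ⊥ := by
  rw [eq_bot_iff]
  rintro f ⟨hf, hfI⟩
  have hn : ∀ z y₁ y₂ x₁ x₃ : ℝ, ∀ g : GL (Fin 4) ℝ, f.1 (expGL (nMat z y₁ y₂ x₁ 0 x₃) * g)
      = Complex.exp (2 * Real.pi * Complex.I * ((y₂ + x₁ : ℝ) : ℂ)) * f.1 g := by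
    intro z y₁ y₂ x₁ x₃ g
    -- Taking `k = 1` isolates the left equivariance.
    have h := hf _ (nMat_mem_sII z y₁ y₂ x₁ x₃) g 1 (one_mem _)
    rw [mul_one, trace_lMat_mul_nMat] at h
    simpa using h
  have h30 : ∀ t : ℝ, ∀ g, f.1 (expGL (t • Matrix.single 3 0 1) * g) = f.1 g := by
    intro t g
    have e : t • Matrix.single (3 : Fin 4) (0 : Fin 4) (1 : ℝ) = nMat t 0 0 0 0 0 := by
      ext i j; fin_cases i <;> fin_cases j <;> simp [nMat]
    rw [e, hn]; simp
  have h32 : ∀ t : ℝ, ∀ g, f.1 (expGL (t • Matrix.single 3 2 1) * g) = f.1 g := by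
    intro t g
    have e : t • Matrix.single (3 : Fin 4) (2 : Fin 4) (1 : ℝ) = nMat 0 0 0 0 0 t := by
      ext i j; fin_cases i <;> fin_cases j <;> simp [nMat]
    rw [e, hn]; simp
  have h31 : ∀ t : ℝ, ∀ g, f.1 (expGL (t • Matrix.single 3 1 1) * g)
      = Complex.exp (2 * Real.pi * Complex.I * t) * f.1 g := by
    intro t g
    have e : t • Matrix.single (3 : Fin 4) (1 : Fin 4) (1 : ℝ) = nMat 0 0 t 0 0 0 := by
      ext i j; fin_cases i <;> fin_cases j <;> simp [nMat]
    rw [e, hn]; simp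
  have h10 : ∀ t : ℝ, ∀ g, f.1 (expGL (t • Matrix.single 1 0 1) * g)
      = Complex.exp (2 * Real.pi * Complex.I * t) * f.1 g := by
    intro t g
    have e : t • Matrix.single (1 : Fin 4) (0 : Fin 4) (1 : ℝ) = nMat 0 0 0 t 0 0 := by
      ext i j; fin_cases i <;> fin_cases j <;> simp [nMat]
    rw [e, hn]; simp
  rw [Submodule.mem_bot]
  ext g
  have hzero : rightAction 4 (adU g⁻¹ (quadU c d 3 0)) f = 0 := by
    rw [adU_quadU]
    simp only [map_sum, map_smul, LinearMap.sum_apply, LinearMap.smul_apply, hfI _ (hI _ _),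
      smul_zero, Finset.sum_const_zero]
  -- In the corner entry, each product has a factor known from `χ`: `E_{41}` for `j = 0, 3`,
  -- `E_{43}` for `j = 2`, and both factors for `j = 1`. The direction `E_{32}`, on which `χ` is not
  -- defined, does not occur.
  have key := rightAction_quadU_conj f g c d (i := 3) (k := 0) (by decide)
  rw [hzero, Fin.sum_univ_four] at key
  have hbr : Matrix.single (3 : Fin 4) (3 : Fin 4) (1 : ℝ) * Matrix.single 3 0 1
      - Matrix.single 3 0 1 * Matrix.single 3 3 1 = Matrix.single 3 0 1 := by
    rw [Matrix.single_mul_single_same, Matrix.single_mul_single_of_ne _ _ _ _ (by decide),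
      mul_one, sub_zero]
  -- For `j = 3` the unknown `E_{44}` stands to the left of `E_{41}`. After the exchange `E_{41}` is
  -- leftmost in both resulting terms, and both vanish.
  rw [deriv_deriv_left_comm f g (Matrix.single 3 3 1), hbr] at key
  simp only [h30, h31, h32, h10, deriv_const, deriv_cexp_mul_const, deriv_const_mul_field] at key
  change (0 : ℂ) = _ at key
  have hpi : 2 * (Real.pi : ℂ) * Complex.I ≠ 0 := Complex.two_pi_I_ne_zero
  -- What remains is `(2πi)² f(g) = 0`.
  simpa [hpi] using key.symm

theorem card_twoBlocks {k : ℕ} (hk : k ≤ 4) :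
    (Finset.univ.filter fun j => twoBlocks k j = 0).card = k := by
  interval_cases k <;> decide

end GenWhittaker

end

theorem mainTheorem7 (k : ℕ) (hk : k = 1 ∨ k = 2) (lam₁ lam₂ : ℂ)
    (hlam : ∀ m : ℤ, lam₁ - lam₂ ≠ (m : ℂ)) :
    GenWhittaker.whittakerSpace GenWhittaker.sII (GenWhittaker.lMat 0 0 1 1 0 0)
        (GenWhittaker.idealI k lam₁ lam₂) = ⊥ ∧
      (GenWhittaker.whittakerSpace GenWhittaker.sII (GenWhittaker.lMat 0 0 1 1 0 0)
        (GenWhittaker.idealI k lam₁ lam₂)).map GenWhittaker.xiII = ⊥ := by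
  -- The first block has `N = k` elements, which fixes `c = λ₁ + λ₂ + k` and `d = λ₁(λ₂ + k)`.
  have h := GenWhittaker.whittakerSpace_sII_eq_bot (GenWhittaker.quadU_mem_annIdeal
    (GenWhittaker.twoBlocks k) ![lam₁, lam₂] (GenWhittaker.card_twoBlocks (k := k) (by omega)))
  have h' : GenWhittaker.whittakerSpace GenWhittaker.sII (GenWhittaker.lMat 0 0 1 1 0 0)
      (GenWhittaker.idealI k lam₁ lam₂) = ⊥ := h
  rw [h', Submodule.map_bot]
  exact ⟨rfl, rfl⟩
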